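/- Let $Q=(Q_0,Q_1)$ be a finite quiver (cycles and multiple arrows are allowed), let $n=(n_x)_{x\in Q_0}$ be a dimension vector of nonnegative integers, and put $V_x=\mathbb C^{n_x}$ with standard basis $e_1,\dots,e_{n_x}$. Let $\mathcal H_Q(\mathcal V)=\bigoplus_{a:x\to y}\mathrm{Hom}(V_x,V_y)$ be the space of representations of $Q$ on $\mathcal V=(V_x)_x$, with the action $(g\cdot v)_a=g_y v_a g_x^{-1}$ ($a:x\to y$) of $\mathrm{GL}_Q(\mathcal V)=\prod_x \mathrm{GL}(V_x)$, and let $\mathrm{Sym}^*(\mathcal H_Q(\mathcal V))$ be the space of polynomial functions on $\mathcal H_Q(\mathcal V)$, with the action $(g\cdot P)(v)=P(g^{-1}\cdot v)$. Let $B_x\subseteq \mathrm{GL}(V_x)$ be the group of upper-triangular matrices. For a subset $K_x\subseteq\{1,\dots,n_x\}$ let $\Omega(K_x)$ be the Schubert variety, i.e. the closure in the Grassmannian $\mathrm{Gr}(|K_x|,V_x)$ of the $B_x$-orbit of $\bigoplus_{k\in K_x}\mathbb C e_k$. A family $\mathcal K=(K_x)_{x\in Q_0}$ of such subsets is called $Q$-intersecting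 if for every $v\in\mathcal H_Q(\mathcal V)$ there are subspaces $S_x\in\Omega(K_x)$, $x\in Q_0$, with $v_a S_x\subseteq S_y$ for every arrow $a:x\to y$. Let $\lambda=(\lambda_x)_{x\in Q_0}$ be a dominant weight, i.e. $\lambda_x:\{1,\dots,n_x\}\to\mathbb Z$ is non-increasing for every $x$, and let $V_\lambda$ be the irreducible rational representation of $\mathrm{GL}_Q(\mathcal V)$ with highest weight $\lambda$ (with respect to $\prod_x B_x$). Suppose that $V_\lambda$ occurs with nonzero multiplicity in $\mathrm{Sym}^*(\mathcal H_Q(\mathcal V))$. Then $$\sum_{x\in Q_0}\sum_{j=1}^{n_x}\lambda_x(j)=0,$$ and for every $Q$-intersecting family of subsets $\mathcal K$, $$\sum_{x\in Q_0}\sum_{k\in K_x}\lambda_x(k)\le 0.$$ -/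

import Mathlib

/-- `V_x = ℂ^m`, with standard basis indexed by `Fin m`. -/
abbrev CVec (m : ℕ) : Type := Fin m → ℂ

/-- The Borel subgroup of upper-triangular matrices in `GL(m, ℂ)`, that is, the stabilizer of the
standard complete flag of `ℂ^m`. -/
noncomputable def stdBorel (m : ℕ) : Subgroup (GL (Fin m) ℂ) where
  carrier := {b | ∀ i j : Fin m, j < i → (b : Matrix (Fin m) (Fin m) ℂ) i j = 0}
  mul_mem' := by
    intro a b ha hb
    have h := Matrix.BlockTriangular.mul (b := (id : Fin m → Fin m))
      (M := (a : Matrix (Fin m) (Fin m) ℂ)) (N := (b : Matrix (Fin m) (Fin m) ℂ))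
      (fun i j hij => ha i j hij) (fun i j hij => hb i j hij)
    intro i j hij
    simpa using h hij
  one_mem' := by
    intro i j hij
    simpa using Matrix.one_apply_ne hij.ne'
  inv_mem' := by
    intro a ha i j hij
    have h := Matrix.blockTriangular_inv_of_blockTriangular (b := (id : Fin m → Fin m))
      (M := (a : Matrix (Fin m) (Fin m) ℂ)) (fun i j hij => ha i j hij)
    simpa using h hij

/-- The Grassmannian of `r`-dimensional linear subspaces of `ℂ^m`. -/
structure Gr (r m : ℕ) : Type where
  space : Submodule ℂ (CVec m)
  finrank_space : Module.finrank ℂ space = r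

/-- Linearly independent `r`-tuples of vectors in `ℂ^m` (the non-compact Stiefel manifold). -/
abbrev GrFrame (r m : ℕ) : Type := {f : Fin r → CVec m // LinearIndependent ℂ f}

/-- The span of a frame, a point of the Grassmannian. -/
def GrFrame.toGr {r m : ℕ} (f : GrFrame r m) : Gr r m :=
  ⟨Submodule.span ℂ (Set.range f.1), by simpa using finrank_span_eq_card f.2⟩

/-- The Grassmannian carries the quotient topology of the space of frames. -/
noncomputable instance Gr.instTopologicalSpace (r m : ℕ) : TopologicalSpace (Gr r m) :=
  TopologicalSpace.coinduced GrFrame.toGr inferInstance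

/-- The action of `GL(m, ℂ)` on the Grassmannian, `S ↦ g S`. -/
noncomputable def Gr.translate {r m : ℕ} (g : GL (Fin m) ℂ) (S : Gr r m) : Gr r m :=
  ⟨S.space.map (Matrix.mulVecLin (g : Matrix (Fin m) (Fin m) ℂ)), by
    have hinj : Function.Injective (Matrix.mulVecLin (g : Matrix (Fin m) (Fin m) ℂ)) := by
      have h := Matrix.mulVec_injective_of_isUnit g.isUnit
      intro a b hab
      exact h (by simpa using hab)
    exact (LinearEquiv.finrank_eq (Submodule.equivMapOfInjective _ hinj S.space)).symm.trans
      S.finrank_space⟩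

/-- The coordinate subspace `S_K = ⨁_{j ∈ K} ℂ e_j` of `ℂ^m`. -/
def coordSubspace {m : ℕ} (K : Finset (Fin m)) : Gr K.card m :=
  ⟨Submodule.span ℂ (Set.range fun j : K => (Pi.single (j : Fin m) (1 : ℂ) : CVec m)), by
    have h : LinearIndependent ℂ (fun j : K => (Pi.single (j : Fin m) (1 : ℂ) : CVec m)) :=
      (Pi.linearIndependent_single_one (Fin m) ℂ).comp _ Subtype.val_injective
    simpa using finrank_span_eq_card h⟩

/-- The Schubert cell of `K`: the orbit of `S_K` under the Borel subgroup. -/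
def schubertCell {m : ℕ} (K : Finset (Fin m)) : Set (Gr K.card m) :=
  {S | ∃ b ∈ stdBorel m, S = Gr.translate b (coordSubspace K)}

/-- The Schubert variety of `K`: the closure of the Schubert cell in the Grassmannian. -/
def schubertVariety {m : ℕ} (K : Finset (Fin m)) : Set (Gr K.card m) :=
  closure (schubertCell K)

section QuiverRep

universe v u

variable {Q : Type u} [Quiver.{v} Q]

/-- The space `H_Q(V) = ⨁_{a : x → y} Hom(V_x, V_y)` of representations of the quiver on
`V_x = ℂ^{n_x}`. -/
abbrev QRep (n : Q → ℕ) : Type (max u v) :=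
  ∀ (x y : Q), (x ⟶ y) → Matrix (Fin (n y)) (Fin (n x)) ℂ

/-- The group `GL_Q(V) = ∏_x GL(V_x)`. -/
abbrev GLQ (n : Q → ℕ) : Type u := ∀ x : Q, GL (Fin (n x)) ℂ

/-- The action of `GL_Q(V)` on `H_Q(V)`: `(g · v)_a = g_y v_a g_x⁻¹` for `a : x → y`. -/
noncomputable def quiverAction (n : Q → ℕ) : Representation ℂ (GLQ n) (QRep n) where
  toFun g :=
    { toFun := fun v x y a =>
        (g y : Matrix (Fin (n y)) (Fin (n y)) ℂ) * v x y a *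
          ((g x)⁻¹ : GL (Fin (n x)) ℂ).1
      map_add' := by
        intro v w; funext x y a
        simp only [Pi.add_apply, Matrix.mul_add, Matrix.add_mul]
      map_smul' := by
        intro c v; funext x y a
        simp only [Pi.smul_apply, Matrix.mul_smul, Matrix.smul_mul, RingHom.id_apply] }
  map_one' := by
    ext1 v; funext x y a
    simp
  map_mul' := by
    intro g h
    ext1 v; funext x y a
    simp [Matrix.mul_assoc, mul_inv_rev]

/-- The algebra of polynomial functions on a complex vector space: the algebra of functions
generated by the linear functionals. -/
def polyFun (H : Type*) [AddCommGroup H] [Module ℂ H] : Subalgebra ℂ (H → ℂ) :=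
  Algebra.adjoin ℂ (Set.range fun l : Module.Dual ℂ H => (l : H → ℂ))

theorem polyFun_comp {H : Type*} [AddCommGroup H] [Module ℂ H] (T : H →ₗ[ℂ] H) {P : H → ℂ}
    (hP : P ∈ polyFun H) : (fun v => P (T v)) ∈ polyFun H := by
  induction hP using Algebra.adjoin_induction with
  | mem f hf =>
    obtain ⟨l, rfl⟩ := hf
    exact Algebra.subset_adjoin ⟨l.comp T, rfl⟩
  | algebraMap c => exact (polyFun H).algebraMap_mem c
  | add f g _ _ hf hg => exact (polyFun H).add_mem hf hg
  | mul f g _ _ hf hg => exact (polyFun H).mul_mem hf hg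

/-- The action of `GL_Q(V)` on the space of polynomial functions on `H_Q(V)`:
`(g · P)(v) = P(g⁻¹ · v)`. -/
noncomputable def symRep (n : Q → ℕ) : Representation ℂ (GLQ n) (polyFun (QRep n)) where
  toFun g :=
    { toFun := fun P => ⟨fun v => P.1 (quiverAction n g⁻¹ v), polyFun_comp _ P.2⟩
      map_add' := by intro P R; rfl
      map_smul' := by intro c P; rfl }
  map_one' := by
    ext P v
    simp
  map_mul' := by
    intro g h
    ext P v
    simp [mul_inv_rev]

/-- The Borel subgroup `B_Q = ∏_x B_x` of `GL_Q(V)`. -/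
noncomputable def borelQ (n : Q → ℕ) : Subgroup (GLQ n) :=
  Subgroup.pi Set.univ fun x => stdBorel (n x)

/-- The character `∏_x ∏_j (b_x)_{jj}^{λ_x(j)}` of the Borel subgroup attached to a weight. -/
noncomputable def weightChar [Fintype Q] {n : Q → ℕ} (lam : ∀ x, Fin (n x) → ℤ) (b : GLQ n) : ℂ :=
  ∏ x, ∏ j, ((b x : Matrix (Fin (n x)) (Fin (n x)) ℂ) j j) ^ lam x j

/-- Dominance of a weight: every `λ_x` is non-increasing. -/
def IsDominantWeight {n : Q → ℕ} (lam : ∀ x, Fin (n x) → ℤ) : Prop :=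
  ∀ x, Antitone (lam x)

/-- The regular functions on the algebraic group `GL_Q(V)`: the algebra generated by the matrix
entries of all `g_x` and `g_x⁻¹`. -/
def regFun (n : Q → ℕ) : Subalgebra ℂ (GLQ n → ℂ) :=
  Algebra.adjoin ℂ
    ({f | ∃ (x : Q) (i j : Fin (n x)), f = fun g => (g x).1 i j} ∪
     {f | ∃ (x : Q) (i j : Fin (n x)), f = fun g => ((g x)⁻¹ : GL (Fin (n x)) ℂ).1 i j})

/-- `ρ` is (a model of) `V_λ`: a finite-dimensional rational irreducible representation of
`GL_Q(V)` with a highest weight vector of weight `λ`. -/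
structure IsIrrepOfHighestWeight [Fintype Q] {n : Q → ℕ} (lam : ∀ x, Fin (n x) → ℤ)
    {W : Type*} [AddCommGroup W] [Module ℂ W] (ρ : Representation ℂ (GLQ n) W) : Prop where
  finiteDimensional : FiniteDimensional ℂ W
  rational : ∀ (w : W) (l : Module.Dual ℂ W), (fun g => l (ρ g w)) ∈ regFun n
  irreducible : ρ.IsIrreducible
  highestWeight : ∃ w : W, w ≠ 0 ∧ ∀ b ∈ borelQ n, ρ b w = weightChar lam b • w

/-- The multiplicity of an irreducible representation `ρ` in `Sym^*(H_Q(V))`: the dimension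
(a cardinal, as it may be infinite when the quiver has cycles) of the space of equivariant linear
maps from `ρ` to `Sym^*(H_Q(V))`. -/
noncomputable def multiplicityInSym {n : Q → ℕ} {W : Type*} [AddCommGroup W] [Module ℂ W]
    (ρ : Representation ℂ (GLQ n) W) : Cardinal :=
  Module.rank ℂ (Representation.IntertwiningMap ρ (symRep n))

/-- `K` is `Q`-intersecting: every quiver representation `v` on `V` has a subrepresentation in
the Schubert variety `Ω(K) = ∏_x Ω(K_x)`. -/
def IsQIntersecting (n : Q → ℕ) (K : ∀ x, Finset (Fin (n x))) : Prop :=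
  ∀ v : QRep n, ∃ S : ∀ x, Gr (K x).card (n x),
    (∀ x, S x ∈ schubertVariety (K x)) ∧
    ∀ (x y : Q) (a : x ⟶ y), (S x).space.map (Matrix.mulVecLin (v x y a)) ≤ (S y).space

end QuiverRep

/-! An occurrence of $V_\lambda$ yields a polynomial $P\neq0$ that is semi-invariant of weight
$\lambda$ under the Borel subgroup (`exists_semiinvariant`). Scalars act trivially on
representations, so the total weight vanishes.

For the inequality, take $v$ with $P(v)\neq0$ and an invariant family $S_x\in\Omega(K_x)$. By Bruhat
decomposition $S_x=b_x\mathbb C^{J_x}$, and membership in the Schubert variety puts $J_x$ weakly to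
the left of $K_x$. Dominance then gives $\lambda(K)\le\lambda(J)$
(`sum_le_sum_of_mem_schubertVariety`). Replacing $v$ by $b^{-1}v$ keeps $P$ nonzero and makes each
$\mathbb C^{J_x}$ invariant. The one-parameter subgroup scaling $J$ then has a limit on $v$, and if
$\lambda(J)>0$, polynomiality of $P$ would force $P(v)=0$ (`sum_weight_nonpos_of_invariant`). -/

/-! ### Comparison of subsets by tail counts. -/

/-- Replacing a set of positions by one that lies weakly to the left does not decrease
the sum of an antitone function. -/
theorem sum_le_sum_of_card_tail_le {m : ℕ} {f : Fin m → ℤ} (hf : Antitone f)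
    {J K : Finset (Fin m)} (hcard : J.card = K.card)
    (h : ∀ i, (J.filter (i ≤ ·)).card ≤ (K.filter (i ≤ ·)).card) :
    ∑ k ∈ K, f k ≤ ∑ j ∈ J, f j := by
  have tail : ∀ (s : Finset (Fin m)) (hs : s.card = K.card) (i : Fin m),
      (s.filter (i ≤ ·)).card =
        (Finset.univ.filter fun l : Fin K.card => i ≤ s.orderEmbOfFin hs l).card := by
    intro s hs i
    conv_lhs => rw [← Finset.map_orderEmbOfFin_univ s hs]
    rw [Finset.filter_map, Finset.card_map]
    rfl
  -- If the `l`-th element of `K` were left of the `l`-th element of `J`, the tail starting at the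
  -- latter would contain more of `J` than of `K`.
  have hle : ∀ l, J.orderEmbOfFin hcard l ≤ K.orderEmbOfFin rfl l := by
    intro l
    by_contra! hlt
    have h1 := h (J.orderEmbOfFin hcard l)
    rw [tail J hcard, tail K rfl] at h1
    refine absurd h1 (not_le.2 (Finset.card_lt_card ?_))
    rw [Finset.ssubset_iff_of_subset]
    · exact ⟨l, by simp, by simpa using hlt⟩
    · intro l' hl'
      simp only [Finset.mem_filter, Finset.mem_univ, true_and, OrderEmbedding.le_iff_le] at hl' ⊢
      by_contra! hlt'
      have := (K.orderEmbOfFin rfl).monotone hlt'.le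
      exact absurd (hlt.trans_le hl') (not_lt.2 this)
  have hsum : ∀ (s : Finset (Fin m)) (hs : s.card = K.card),
      ∑ j ∈ s, f j = ∑ l, f (s.orderEmbOfFin hs l) := by
    intro s hs
    conv_lhs => rw [← Finset.map_orderEmbOfFin_univ s hs]
    rw [Finset.sum_map]
    rfl
  rw [hsum J hcard, hsum K rfl]
  exact Finset.sum_le_sum fun l _ => hf (hle l)

/-! ### Bruhat decomposition of the Grassmannian. -/

theorem isUnit_det_of_upperTriangular {m : ℕ} {M : Matrix (Fin m) (Fin m) ℂ}
    (h : ∀ i j, j < i → M i j = 0) (hd : ∀ j, M j j ≠ 0) : IsUnit M.det := by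
  have hM : M.BlockTriangular id := fun i j hij => h i j hij
  rw [Matrix.det_of_isUpperTriangular hM]
  exact (Finset.prod_ne_zero_iff.2 fun j _ => hd j).isUnit

theorem stdBorel_diag_ne_zero {m : ℕ} {b : GL (Fin m) ℂ} (hb : b ∈ stdBorel m) (j : Fin m) :
    (b : Matrix (Fin m) (Fin m) ℂ) j j ≠ 0 := by
  have hM : (b : Matrix (Fin m) (Fin m) ℂ).BlockTriangular id := fun i j hij => hb i j hij
  have hdet := (Matrix.isUnit_iff_isUnit_det _).1 b.isUnit
  rw [Matrix.det_of_isUpperTriangular hM] at hdet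
  exact Finset.prod_ne_zero_iff.1 hdet.ne_zero j (Finset.mem_univ j)

theorem mem_coordSubspace {m : ℕ} {J : Finset (Fin m)} {w : CVec m} :
    w ∈ (coordSubspace J).space ↔ ∀ c, c ∉ J → w c = 0 := by
  constructor
  · intro hw c hc
    have : (coordSubspace J).space ≤ LinearMap.ker (LinearMap.proj c : CVec m →ₗ[ℂ] ℂ) := by
      refine Submodule.span_le.2 ?_
      rintro _ ⟨j, rfl⟩
      have : c ≠ j := fun h => hc (h ▸ j.2)
      simp [this]
    exact this hw
  · intro hw
    have : w = ∑ j : J, w j • (Pi.single (j : Fin m) (1 : ℂ) : CVec m) := by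
      rw [Finset.sum_coe_sort J fun j => w j • (Pi.single j (1 : ℂ) : CVec m)]
      funext c
      by_cases hc : c ∈ J
      · simp [Finset.sum_apply, Pi.single_apply, hc]
      · simp [Finset.sum_apply, Pi.single_apply, hc, hw c hc]
    rw [this]
    exact Submodule.sum_mem _ fun j _ =>
      Submodule.smul_mem _ _ (Submodule.subset_span ⟨j, rfl⟩)

/-- The Bruhat decomposition of the Grassmannian: every subspace is a Borel translate of a
coordinate subspace. -/
theorem exists_eq_map_coordSubspace {m : ℕ} (S : Submodule ℂ (CVec m)) :
    ∃ (J : Finset (Fin m)), ∃ b ∈ stdBorel m,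
      S = (coordSubspace J).space.map (Matrix.mulVecLin (b : Matrix (Fin m) (Fin m) ℂ)) := by
  classical
  -- The pivots: positions of the last nonzero coordinate of vectors in `S`. Off `J`, the columns
  -- are filled with basis vectors to make the matrix invertible.
  let J : Finset (Fin m) := Finset.univ.filter fun j => ∃ s ∈ S, s j ≠ 0 ∧ ∀ a, j < a → s a = 0
  have hu : ∀ j, ∃ s : CVec m, (j ∈ J → s ∈ S) ∧ s j ≠ 0 ∧ ∀ a, j < a → s a = 0 := by
    intro j
    by_cases hj : j ∈ J
    · obtain ⟨s, hs, h⟩ := (Finset.mem_filter.1 hj).2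
      exact ⟨s, fun _ => hs, h⟩
    · exact ⟨Pi.single j 1, fun h => absurd h hj, by simp,
        fun a ha => by simp [ha.ne']⟩
  choose u huS hud hut using hu
  let M : Matrix (Fin m) (Fin m) ℂ := Matrix.of fun i j => u j i
  have hM : IsUnit M.det := isUnit_det_of_upperTriangular (fun i j hij => hut j i hij) hud
  let b : GL (Fin m) ℂ := ((Matrix.isUnit_iff_isUnit_det M).2 hM).unit
  have hcol : ∀ j, M.mulVecLin (Pi.single j 1) = u j := by
    intro j
    ext i
    simp [M]
  refine ⟨J, b, fun i j hij => hut j i hij, ?_⟩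
  change S = Submodule.map M.mulVecLin (Submodule.span ℂ _)
  rw [Submodule.map_span, ← Set.range_comp]
  have hfun : (M.mulVecLin ∘ fun j : J => (Pi.single (j : Fin m) (1 : ℂ) : CVec m)) =
      fun j : J => u j := funext fun j => hcol j
  rw [hfun]
  apply le_antisymm
  -- Gaussian elimination from the last coordinate: `i` bounds the support, and subtracting a
  -- multiple of a pivot vector lowers it.
  · have key : ∀ (i : ℕ) (s : CVec m), s ∈ S → (∀ a : Fin m, i ≤ a → s a = 0) →
        s ∈ Submodule.span ℂ (Set.range fun j : J => u j) := by
      intro i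
      induction i with
      | zero =>
        intro s _ h
        have : s = 0 := funext fun a => h a (Nat.zero_le _)
        rw [this]
        exact Submodule.zero_mem _
      | succ i ih =>
        intro s hs h
        by_cases him : ∃ a : Fin m, (a : ℕ) = i ∧ s a ≠ 0
        · obtain ⟨j, rfl, hj⟩ := him
          have hjJ : j ∈ J := Finset.mem_filter.2
            ⟨Finset.mem_univ _, s, hs, hj, fun a ha => h a ha⟩
          have h1 : s - (s j / u j j) • u j ∈ Submodule.span ℂ (Set.range fun j : J => u j) := by
            refine ih _ (S.sub_mem hs (S.smul_mem _ (huS j hjJ))) fun a ha => ?_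
            rcases ha.lt_or_eq with ha | ha
            · simp [h a ha, hut j a ha]
            · obtain rfl : j = a := Fin.ext ha
              simp [hud j]
          have h2 : (s j / u j j) • u j ∈ Submodule.span ℂ (Set.range fun j : J => u j) :=
            Submodule.smul_mem _ _ (Submodule.subset_span ⟨⟨j, hjJ⟩, rfl⟩)
          simpa using Submodule.add_mem _ h1 h2
        · push Not at him
          refine ih s hs fun a ha => ?_
          rcases ha.lt_or_eq with ha | ha
          · exact h a ha
          · exact him a ha.symm
    intro s hs
    exact key m s hs fun a ha => absurd a.2 (not_lt.2 ha)
  · refine Submodule.span_le.2 ?_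
    rintro _ ⟨j, rfl⟩
    exact huS j j.2

/-! ### Tail ranks and Schubert varieties. -/

/-- The projection of `ℂ^m` onto the coordinates with index at least `i`. -/
def tailProj {m : ℕ} (i : Fin m) : CVec m →ₗ[ℂ] CVec m :=
  LinearMap.pi fun a => if i ≤ a then LinearMap.proj a else 0

theorem tailProj_apply {m : ℕ} (i : Fin m) (w : CVec m) (a : Fin m) :
    tailProj i w a = if i ≤ a then w a else 0 := by
  simp only [tailProj, LinearMap.pi_apply]
  split_ifs <;> rfl

/-- The tail ranks are constant along Schubert cells. -/
theorem finrank_tailProj_map_coordSubspace {m : ℕ} (J : Finset (Fin m)) {b : GL (Fin m) ℂ}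
    (hb : b ∈ stdBorel m) (i : Fin m) :
    Module.finrank ℂ (((coordSubspace J).space.map
      (Matrix.mulVecLin (b : Matrix (Fin m) (Fin m) ℂ))).map (tailProj i)) =
      (J.filter (i ≤ ·)).card := by
  classical
  -- Projected columns of `b` from `i` on, completed by identity columns: still triangular and
  -- invertible, so the projected columns are independent. Columns before `i` project to zero.
  let M : Matrix (Fin m) (Fin m) ℂ := Matrix.of fun a j => if i ≤ j then
    (if i ≤ a then (b : Matrix (Fin m) (Fin m) ℂ) a j else 0) else (1 : Matrix _ _ ℂ) a j
  have hM : IsUnit M.det := by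
    apply isUnit_det_of_upperTriangular
    · intro a j hja
      simp only [M, Matrix.of_apply]
      split_ifs
      · exact hb a j hja
      · rfl
      · exact Matrix.one_apply_ne hja.ne'
    · intro j
      simp only [M, Matrix.of_apply]
      split_ifs
      · exact stdBorel_diag_ne_zero hb j
      · simp
  have hli : LinearIndependent ℂ M.col :=
    Matrix.linearIndependent_cols_iff_isUnit.2 ((Matrix.isUnit_iff_isUnit_det M).2 hM)
  have hcol : ∀ j, tailProj i ((b : Matrix (Fin m) (Fin m) ℂ).mulVecLin (Pi.single j 1)) =
      if i ≤ j then M.col j else 0 := by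
    intro j
    ext a
    rw [tailProj_apply]
    by_cases hj : i ≤ j
    · simp [M, hj, Matrix.col]
    · by_cases ha : i ≤ a
      · simp [hj, ha, hb a j ((not_le.1 hj).trans_le ha)]
      · simp [hj, ha]
  have hspan : ((coordSubspace J).space.map
      (Matrix.mulVecLin (b : Matrix (Fin m) (Fin m) ℂ))).map (tailProj i) =
      Submodule.span ℂ (Set.range fun j : J.filter (i ≤ ·) => M.col j) := by
    change Submodule.map _ (Submodule.map _ (Submodule.span ℂ _)) = _
    rw [Submodule.map_span, Submodule.map_span, ← Set.range_comp, ← Set.range_comp]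
    apply le_antisymm
    · refine Submodule.span_le.2 ?_
      rintro _ ⟨j, rfl⟩
      simp only [Function.comp_apply, hcol]
      split_ifs with hj
      · exact Submodule.subset_span ⟨⟨j, Finset.mem_filter.2 ⟨j.2, hj⟩⟩, rfl⟩
      · exact Submodule.zero_mem _
    · refine Submodule.span_le.2 ?_
      rintro _ ⟨j, rfl⟩
      obtain ⟨hjJ, hj⟩ := Finset.mem_filter.1 j.2
      refine Submodule.subset_span ⟨⟨j, hjJ⟩, ?_⟩
      simp only [Function.comp_apply, hcol, if_pos hj]
  have hliJ : LinearIndependent ℂ fun j : J.filter (i ≤ ·) => M.col j :=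
    hli.comp _ Subtype.val_injective
  rw [hspan, finrank_span_eq_card hliJ, Fintype.card_coe]

/-- Lower semicontinuity of rank, checked on frames because the Grassmannian has the quotient
topology. -/
theorem isClosed_setOf_finrank_map_le {r m : ℕ} (p : CVec m →ₗ[ℂ] CVec m) (k : ℕ) :
    IsClosed {S : Gr r m | Module.finrank ℂ (S.space.map p) ≤ k} := by
  rw [← isOpen_compl_iff]
  refine isOpen_coinduced.2 ?_
  -- A frame is sent to `p` composed with its linear-combination map, whose range is the image of
  -- the spanned subspace.
  let T : (Fin r → CVec m) →ₗ[ℂ] ((Fin r → ℂ) →L[ℂ] CVec m) :=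
    (LinearMap.toContinuousLinearMap.toLinearMap ∘ₗ LinearMap.llcomp ℂ _ _ _ p) ∘ₗ
      Fintype.bilinearCombination ℂ ℂ
  have hT : Continuous T := T.continuous_of_finiteDimensional
  have hopen := (isOpen_setOfPred_nat_le_rank (𝕜 := ℂ) (E := Fin r → ℂ) (F := CVec m)
    (k + 1)).preimage (hT.comp continuous_subtype_val :
      Continuous fun f : GrFrame r m => T f.1)
  convert hopen using 1
  ext f
  have hf : (T f.1 : (Fin r → ℂ) →ₗ[ℂ] CVec m) = p ∘ₗ Fintype.linearCombination ℂ f.1 := rfl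
  have hrange : LinearMap.range (T f.1 : (Fin r → ℂ) →ₗ[ℂ] CVec m) = f.toGr.space.map p := by
    rw [hf, LinearMap.range_comp, Fintype.range_linearCombination]
    rfl
  simp only [Set.mem_preimage, Set.mem_compl_iff, Set.mem_ofPred_eq, Function.comp_apply, not_le,
    LinearMap.rank, ← Module.finrank_eq_rank, Nat.cast_le, Nat.succ_le_iff]
  rw [← hrange]

/-- Upper bounds on tail ranks are closed conditions, so they pass from the cell of `K` to its
closure. -/
theorem sum_le_sum_of_mem_schubertVariety {m : ℕ} {f : Fin m → ℤ} (hf : Antitone f)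
    {J K : Finset (Fin m)} {S : Gr K.card m} (hS : S ∈ schubertVariety K)
    {b : GL (Fin m) ℂ} (hb : b ∈ stdBorel m)
    (hSb : S.space =
      (coordSubspace J).space.map (Matrix.mulVecLin (b : Matrix (Fin m) (Fin m) ℂ))) :
    ∑ k ∈ K, f k ≤ ∑ j ∈ J, f j := by
  refine sum_le_sum_of_card_tail_le hf ?_ fun i => ?_
  · have h := (Gr.translate b (coordSubspace J)).finrank_space
    rw [← h, ← S.finrank_space, hSb]
    rfl
  · have hsub : schubertVariety K ⊆ {S : Gr K.card m |
        Module.finrank ℂ (S.space.map (tailProj i)) ≤ (K.filter (i ≤ ·)).card} := by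
      refine closure_minimal ?_ (isClosed_setOf_finrank_map_le _ _)
      rintro _ ⟨c, hc, rfl⟩
      exact (finrank_tailProj_map_coordSubspace K hc i).le
    have h := hsub hS
    rwa [Set.mem_ofPred_eq, hSb, finrank_tailProj_map_coordSubspace J hb i] at h

/-! ### One-parameter subgroups and weights of semi-invariants. -/

/-- An invertible diagonal matrix. -/
def diagGL {m : ℕ} (d : Fin m → ℂˣ) : GL (Fin m) ℂ where
  val := Matrix.diagonal fun j => (d j : ℂ)
  inv := Matrix.diagonal fun j => ((d j)⁻¹ : ℂˣ).1
  val_inv := by simp [Matrix.diagonal_mul_diagonal]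
  inv_val := by simp [Matrix.diagonal_mul_diagonal]

theorem diagGL_inv {m : ℕ} (d : Fin m → ℂˣ) : (diagGL d)⁻¹ = diagGL d⁻¹ :=
  Units.ext rfl

theorem diagGL_mem_stdBorel {m : ℕ} (d : Fin m → ℂˣ) : diagGL d ∈ stdBorel m :=
  fun _ _ hij => Matrix.diagonal_apply_ne _ hij.ne'

theorem exists_polynomial_of_mem_polyFun {H : Type*} [AddCommGroup H] [Module ℂ H] {P : H → ℂ}
    (hP : P ∈ polyFun H) (v w : H) :
    ∃ p : Polynomial ℂ, ∀ s : ℂ, P (v + s • w) = p.eval s := by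
  induction hP using Algebra.adjoin_induction with
  | mem f hf =>
    obtain ⟨l, rfl⟩ := hf
    exact ⟨Polynomial.C (l v) + Polynomial.C (l w) * Polynomial.X, fun s => by simp [mul_comm s]⟩
  | algebraMap c => exact ⟨Polynomial.C c, fun s => by simp⟩
  | add f g _ _ hf hg =>
    obtain ⟨p, hp⟩ := hf
    obtain ⟨q, hq⟩ := hg
    exact ⟨p + q, fun s => by simp [hp, hq]⟩
  | mul f g _ _ hf hg =>
    obtain ⟨p, hp⟩ := hf
    obtain ⟨q, hq⟩ := hg
    exact ⟨p * q, fun s => by simp [hp, hq]⟩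

theorem complex_zpow_sum {ι : Type*} {t : ℂ} (ht : t ≠ 0) (s : Finset ι) (f : ι → ℤ) :
    t ^ (∑ i ∈ s, f i) = ∏ i ∈ s, t ^ f i := by
  classical
  induction s using Finset.induction_on with
  | empty => simp
  | insert a s ha ih => rw [Finset.sum_insert ha, Finset.prod_insert ha, zpow_add₀ ht, ih]

section QuiverWeights

universe v u

variable {Q : Type u} [Quiver.{v} Q]

/-- The one-parameter subgroup of `GL_Q(V)` scaling the coordinates in `J` by `t`. -/
noncomputable def scaleGLQ {n : Q → ℕ} (J : ∀ x, Finset (Fin (n x))) (t : ℂˣ) : GLQ n :=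
  fun _ => diagGL fun j => if j ∈ J _ then t else 1

omit [Quiver.{v} Q] in
theorem scaleGLQ_mem_borelQ {n : Q → ℕ} (J : ∀ x, Finset (Fin (n x))) (t : ℂˣ) :
    scaleGLQ J t ∈ borelQ n :=
  fun _ _ => diagGL_mem_stdBorel _

omit [Quiver.{v} Q] in
theorem weightChar_scaleGLQ [Fintype Q] {n : Q → ℕ} (lam : ∀ x, Fin (n x) → ℤ)
    (J : ∀ x, Finset (Fin (n x))) (t : ℂˣ) :
    weightChar lam (scaleGLQ J t) = (t : ℂ) ^ (∑ x, ∑ j ∈ J x, lam x j) := by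
  simp only [weightChar, complex_zpow_sum t.ne_zero]
  refine Finset.prod_congr rfl fun x _ => ?_
  rw [← Finset.prod_subset (Finset.subset_univ (J x))]
  · refine Finset.prod_congr rfl fun j hj => ?_
    simp [scaleGLQ, diagGL, hj]
  · intro j _ hj
    simp [scaleGLQ, diagGL, hj]

theorem quiverAction_scaleGLQ_inv_apply {n : Q → ℕ} (J : ∀ x, Finset (Fin (n x))) (t : ℂˣ)
    (v : QRep n) (x y : Q) (a : x ⟶ y) (c : Fin (n y)) (d : Fin (n x)) :
    quiverAction n (scaleGLQ J t)⁻¹ v x y a c d =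
      (if c ∈ J y then (t : ℂ)⁻¹ else 1) * v x y a c d * (if d ∈ J x then (t : ℂ) else 1) := by
  have h1 : ((scaleGLQ J t)⁻¹ y : GL (Fin (n y)) ℂ).1 =
      Matrix.diagonal fun j => if j ∈ J y then (t : ℂ)⁻¹ else 1 := by
    rw [Pi.inv_apply, scaleGLQ, diagGL_inv]
    ext i j
    by_cases hij : i = j
    · subst hij
      by_cases hi : i ∈ J y <;> simp [diagGL, hi]
    · simp [diagGL, hij]
  have h2 : (((scaleGLQ J t)⁻¹ x)⁻¹ : GL (Fin (n x)) ℂ).1 =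
      Matrix.diagonal fun j => if j ∈ J x then (t : ℂ) else 1 := by
    rw [Pi.inv_apply, inv_inv, scaleGLQ]
    ext i j
    by_cases hij : i = j
    · subst hij
      by_cases hi : i ∈ J x <;> simp [diagGL, hi]
    · simp [diagGL, hij]
  change ((((scaleGLQ J t)⁻¹ y : GL (Fin (n y)) ℂ).1) * v x y a *
    (((scaleGLQ J t)⁻¹ x)⁻¹ : GL (Fin (n x)) ℂ).1) c d = _
  rw [h1, h2, Matrix.mul_diagonal, Matrix.diagonal_mul]

/-- A weight occurring in `Sym^*(H_Q(V))` has total sum zero. -/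
theorem sum_weight_eq_zero [Fintype Q] {n : Q → ℕ} {lam : ∀ x, Fin (n x) → ℤ}
    {P : QRep n → ℂ} {v : QRep n} (hv : P v ≠ 0)
    (hb : ∀ b ∈ borelQ n, ∀ v, P (quiverAction n b⁻¹ v) = weightChar lam b * P v) :
    ∑ x, ∑ j, lam x j = 0 := by
  -- Any scalar that is not a root of unity would do; 2 is real, so the order on ℝ gives the
  -- exponent.
  have h := hb _ (scaleGLQ_mem_borelQ (fun _ => Finset.univ) (Units.mk0 2 two_ne_zero)) v
  have hact : quiverAction n
      (scaleGLQ (fun _ => Finset.univ) (Units.mk0 (2 : ℂ) two_ne_zero))⁻¹ v = v := by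
    funext x y a
    ext c d
    rw [quiverAction_scaleGLQ_inv_apply]
    simp
    ring
  rw [hact, weightChar_scaleGLQ, Units.val_mk0] at h
  have h1 := (mul_eq_right₀ hv).1 h.symm
  have h2 : (2 : ℝ) ^ (∑ x, ∑ j, lam x j) = 1 := by
    apply Complex.ofReal_injective
    simpa only [Complex.ofReal_zpow, Complex.ofReal_ofNat, Complex.ofReal_one] using h1
  exact (zpow_eq_one_iff_right₀ (by norm_num) (by norm_num)).1 h2

/-- If a representation `v` leaves the coordinate subspaces of `J` invariant and a semi-invariant
of weight `lam` does not vanish at `v`, then the sum of `lam` over `J` is nonpositive. -/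
theorem sum_weight_nonpos_of_invariant [Fintype Q] {n : Q → ℕ} {lam : ∀ x, Fin (n x) → ℤ}
    {P : QRep n → ℂ} (hP : P ∈ polyFun (QRep n)) {v : QRep n} (hv : P v ≠ 0)
    (hb : ∀ b ∈ borelQ n, ∀ v, P (quiverAction n b⁻¹ v) = weightChar lam b * P v)
    (J : ∀ x, Finset (Fin (n x)))
    (hJ : ∀ x y (a : x ⟶ y) c d, d ∈ J x → c ∉ J y → v x y a c d = 0) :
    ∑ x, ∑ j ∈ J x, lam x j ≤ 0 := by
  by_contra! hpos
  obtain ⟨N, hN⟩ := Int.eq_ofNat_of_zero_le hpos.le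
  have hN0 : N ≠ 0 := by rintro rfl; simp [hN] at hpos
  -- The block from the complement of `J` into `J`: by invariance, the only nonzero block that is
  -- rescaled.
  let v₁ : QRep n := fun x y a => Matrix.of fun c d =>
    if c ∈ J y ∧ d ∉ J x then v x y a c d else 0
  obtain ⟨p, hp⟩ := exists_polynomial_of_mem_polyFun hP (v - v₁) v₁
  have hs : ∀ s : ℂ, s ≠ 0 → s ^ N * p.eval s = P v := by
    intro s hs0
    -- The parameter is inverted so that `v₁` is scaled by `s`, giving a limit at `s = 0`.
    have h := hb _ (scaleGLQ_mem_borelQ J (Units.mk0 s hs0)⁻¹) v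
    have hact : quiverAction n (scaleGLQ J (Units.mk0 s hs0)⁻¹)⁻¹ v = (v - v₁) + s • v₁ := by
      funext x y a
      ext c d
      rw [quiverAction_scaleGLQ_inv_apply]
      by_cases hc : c ∈ J y
      · by_cases hd : d ∈ J x
        · simp [v₁, hc, hd]
          field_simp
        · simp [v₁, hc, hd]
      · by_cases hd : d ∈ J x
        · simp [v₁, hc, hd, hJ x y a c d hd hc]
        · simp [v₁, hc, hd]
    rw [hact, hp, weightChar_scaleGLQ, hN] at h
    rw [h, ← mul_assoc]
    simp [hs0]
  have hpoly : Polynomial.X ^ N * p = Polynomial.C (P v) := by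
    apply Polynomial.eq_of_infinite_eval_eq
    refine Set.Infinite.mono (s := {0}ᶜ) (fun s hs0 => ?_)
      (Set.finite_singleton (0 : ℂ)).infinite_compl
    simpa using hs s hs0
  have h0 := congrArg (Polynomial.eval 0) hpoly
  simp [hN0] at h0
  exact hv h0.symm

/-- A nonzero multiplicity yields a nonzero highest weight vector in `Sym^*(H_Q(V))`. -/
theorem exists_semiinvariant [Fintype Q] {n : Q → ℕ} {lam : ∀ x, Fin (n x) → ℤ}
    {W : Type*} [AddCommGroup W] [Module ℂ W] {ρ : Representation ℂ (GLQ n) W}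
    (hρ : IsIrrepOfHighestWeight lam ρ) (hocc : multiplicityInSym ρ ≠ 0) :
    ∃ P ∈ polyFun (QRep n), (∃ v, P v ≠ 0) ∧
      ∀ b ∈ borelQ n, ∀ v, P (quiverAction n b⁻¹ v) = weightChar lam b * P v := by
  have := hρ.irreducible
  have hnt : Nontrivial (Representation.IntertwiningMap ρ (symRep n)) := by
    by_contra h
    rw [not_nontrivial_iff_subsingleton] at h
    exact hocc (rank_subsingleton' _ _)
  obtain ⟨φ, hφ⟩ := exists_ne (0 : Representation.IntertwiningMap ρ (symRep n))
  have hinj := (Representation.IsIrreducible.injective_or_eq_zero φ).resolve_right hφ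
  obtain ⟨w, hw, hwb⟩ := hρ.highestWeight
  refine ⟨(φ w).1, (φ w).2, ?_, fun b hb v => ?_⟩
  · by_contra! h
    refine hw (hinj ?_)
    rw [map_zero]
    exact Subtype.ext (funext h)
  · have h := Representation.IntertwiningMap.isIntertwining ρ (symRep n) φ b w
    rw [hwb b hb, map_smul] at h
    exact (congrFun (congrArg Subtype.val h) v).symm

end QuiverWeights

theorem mainTheorem12 {Q : Type*} [Quiver Q] [Fintype Q] [∀ x y : Q, Finite (x ⟶ y)]
    (n : Q → ℕ) (lam : ∀ x, Fin (n x) → ℤ) (hdom : IsDominantWeight lam)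
    {W : Type*} [AddCommGroup W] [Module ℂ W] (ρ : Representation ℂ (GLQ n) W)
    (hρ : IsIrrepOfHighestWeight lam ρ) (hocc : multiplicityInSym ρ ≠ 0) :
    (∑ x, ∑ j, lam x j = 0) ∧
    ∀ K : ∀ x, Finset (Fin (n x)), IsQIntersecting n K →
      ∑ x, ∑ k ∈ K x, lam x k ≤ 0 := by
  obtain ⟨P, hP, ⟨v, hv⟩, hb⟩ := exists_semiinvariant hρ hocc
  refine ⟨sum_weight_eq_zero hv hb, fun K hK => ?_⟩
  obtain ⟨S, hSK, hSv⟩ := hK v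
  choose J b hbB hSb using fun x => exists_eq_map_coordSubspace (S x).space
  refine (Finset.sum_le_sum fun x _ =>
    sum_le_sum_of_mem_schubertVariety (hdom x) (hSK x) (hbB x) (hSb x)).trans ?_
  have hbQ : (b : GLQ n) ∈ borelQ n := fun x _ => hbB x
  -- Translation by `b⁻¹` carries the invariant subspaces to coordinate subspaces.
  have hv' : P (quiverAction n (b : GLQ n)⁻¹ v) ≠ 0 := by
    rw [hb _ hbQ]
    refine mul_ne_zero (Finset.prod_ne_zero_iff.2 fun x _ => Finset.prod_ne_zero_iff.2 fun j _ =>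
      zpow_ne_zero _ (stdBorel_diag_ne_zero (hbB x) j)) hv
  refine sum_weight_nonpos_of_invariant hP hv' hb J fun x y a c d hd hc => ?_
  have hd' : (Pi.single d 1 : CVec (n x)) ∈ (coordSubspace (J x)).space :=
    Submodule.subset_span ⟨⟨d, hd⟩, rfl⟩
  have hmem := hSv x y a (Submodule.mem_map_of_mem ((hSb x).symm ▸ Submodule.mem_map_of_mem hd'))
  rw [hSb y] at hmem
  obtain ⟨w, hw, hwv⟩ := hmem
  have hact : (quiverAction n (b : GLQ n)⁻¹ v x y a).mulVec (Pi.single d 1) = w := by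
    change (((b y)⁻¹ : GL (Fin (n y)) ℂ).1 * v x y a * (((b x)⁻¹)⁻¹ : GL (Fin (n x)) ℂ).1).mulVec
      (Pi.single d 1) = w
    rw [inv_inv, Matrix.mul_assoc, ← Matrix.mulVec_mulVec, ← Matrix.mulVec_mulVec]
    simp only [Matrix.mulVecLin_apply] at hwv
    rw [← hwv, Matrix.mulVec_mulVec, Units.inv_mul, Matrix.one_mulVec]
  have h0 := mem_coordSubspace.1 hw c hc
  rw [← hact] at h0
  simpa using h0
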